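/- Let $n\ge 1$, and let $\mathfrak S_m$ denote the group of permutations of $\{1,\dots,m\}$. For $D\subseteq\{1,\dots,m-1\}$ let $$F_{m,D}=\sum_{\substack{i_1\le i_2\le\dots\le i_m\\ i_j<i_{j+1}\text{ if }j\in D}}x_{i_1}x_{i_2}\cdots x_{i_m}$$ be the fundamental quasisymmetric function, a formal power series in countably many variables indexed by a countable set ordered like $\mathbb N$. For $B\subseteq\mathfrak S_m$ put $$\mathcal Q(B)=\sum_{\pi\in B}F_{m,\mathrm{Des}(\pi)},\qquad \mathrm{Des}(\pi)=\{i:\pi(i)>\pi(i+1)\}.$$ For a class function $\chi:\mathfrak S_m\to\mathbb C$ let $$\mathrm{ch}(\chi)=\frac1{m!}\sum_{\pi\in\mathfrak S_m}\chi(\pi)\,p_\pi,$$ where $p_\pi=p_{\lambda_1}p_{\lambda_2}\cdots$ is the power sum symmetric function indexed by the cycle type $\lambda$ of $\pi$ (fixed points count as parts equal to $1$) and $p_k=\sum_i x_i^k$. Identify $\mathfrak S_{n-1}$ with the subgroup of $\mathfrak S_n$ of the permutations that fix $n$, let $C_n=\langle c\rangle\subseteq\mathfrak S_n$ be the cyclic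 subgroup generated by $c=(1,2,\dots,n)$, and for $A\subseteq\mathfrak S_{n-1}$ put $AC_n=\{\pi c^k:\pi\in A,\ 0\le k<n\}\subseteq\mathfrak S_n$, where $(\pi c^k)(i)=\pi(c^k(i))$. Let $\chi$ be the character of a finite-dimensional complex representation of $\mathfrak S_{n-1}$, let $\chi\uparrow^{\mathfrak S_n}$ be the character of the induced representation of $\mathfrak S_n$, and let $A\subseteq\mathfrak S_{n-1}$. If $\mathcal Q(A)=\mathrm{ch}(\chi)$ (with $\mathcal Q(A)$ computed in $\mathfrak S_{n-1}$), then $$\mathcal Q(AC_n)=\mathrm{ch}(\chi\uparrow^{\mathfrak S_n}).$$ -/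

import Mathlib

open scoped Pointwise

noncomputable section

namespace HorizontalRotation

/-- The fundamental quasisymmetric function `F_{n,D}` in the variables `x_0, x_1, …`, for a set
`D ⊆ {1, …, n-1}` of positions: the coefficient of a monomial is the number of sequences
`i_1 ≤ ⋯ ≤ i_n`, with `i_d < i_{d+1}` for `d ∈ D`, such that `x_{i_1} ⋯ x_{i_n}` is that monomial.
Positions are indexed from `0` in `Fin n`, so position `d` (counted from `1`) is the `j : Fin n` with
`j + 1 = d`, and the next position is the `k : Fin n` with `k = d`. -/
def fundamental (n : ℕ) (D : Set ℕ) : MvPowerSeries ℕ ℂ := fun m =>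
  (Nat.card {i : Fin n → ℕ // Monotone i ∧
    (∀ d ∈ D, ∀ j k : Fin n, (j : ℕ) + 1 = d → (k : ℕ) = d → i j < i k) ∧
    ∑ j, Finsupp.single (i j) 1 = m} : ℂ)

/-- The descent set `{d : π(d) > π(d+1)} ⊆ {1, …, n-1}`, positions being counted from `1`. -/
def descentSet {n : ℕ} (π : Equiv.Perm (Fin n)) : Set ℕ :=
  {d | ∃ j k : Fin n, (j : ℕ) + 1 = d ∧ (k : ℕ) = d ∧ π k < π j}

/-- `Q(B) = ∑_{π ∈ B} F_{n, Des(π)}`. -/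
def Q {n : ℕ} (B : Set (Equiv.Perm (Fin n))) : MvPowerSeries ℕ ℂ :=
  ∑ᶠ π ∈ B, fundamental n (descentSet π)

/-- The power sum symmetric function `p_k = ∑_i x_i ^ k` (for `k ≥ 1`): the coefficient of a monomial
is the number of indices `i` such that `x_i ^ k` is that monomial. -/
def powerSum (k : ℕ) : MvPowerSeries ℕ ℂ := fun m =>
  (Nat.card {i : ℕ // Finsupp.single i k = m} : ℂ)

/-- `p_π = p_λ = p_{λ_1} p_{λ_2} ⋯`, where `λ` is the cycle type of `π` (fixed points counted as
parts equal to `1`). -/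
def powerSumPerm {n : ℕ} (π : Equiv.Perm (Fin n)) : MvPowerSeries ℕ ℂ :=
  (π.partition.parts.map powerSum).prod

/-- The Frobenius characteristic `ch(χ) = (1 / n!) ∑_π χ(π) p_π`. -/
def ch {n : ℕ} (χ : Equiv.Perm (Fin n) → ℂ) : MvPowerSeries ℕ ℂ :=
  ((n.factorial : ℂ)⁻¹) • ∑ π, χ π • powerSumPerm π

/-- The embedding of `S_n` in `S_{n+1}` as the permutations that fix the last point. -/
def embed (n : ℕ) : Equiv.Perm (Fin n) →* Equiv.Perm (Fin (n + 1)) :=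
  Equiv.Perm.viaEmbeddingHom Fin.castSuccEmb

/-- The set `A C` of horizontal rotations of the elements of `A ⊆ S_n ⊆ S_{n+1}`, where `C` is the
cyclic subgroup of `S_{n+1}` generated by the long cycle `j ↦ j + 1`. -/
def rotations {n : ℕ} (A : Set (Equiv.Perm (Fin n))) : Set (Equiv.Perm (Fin (n + 1))) :=
  (embed n '' A) * (Subgroup.zpowers (finRotate (n + 1)) : Set (Equiv.Perm (Fin (n + 1))))

end HorizontalRotation

end

/-!
Both sides of the claim are products by `p_1`.

On the character side, `ch (χ↑) = ch χ * p_1` (`ch_ind`). The induced representation is a space of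
coinvariants, so its character is the trace, on `k[H] ⊗ V`, of the group action composed with the
averaging projection (`trace_coinvariants`); this gives the Frobenius formula (`character_ind`) and
then Frobenius reciprocity against an arbitrary class function (`sum_character_ind_smul`), here
`π ↦ p_π`. A permutation of `n` letters seen in `S_{n+1}` has one more fixed point, hence the
factor `p_1`.

On the combinatorial side, `Q (A C) = Q A * p_1` whenever the power series `Q A` is symmetric
(`Q_rotations`); it is so here because it equals `ch χ` (`ch_mapDomain`). If the word `w` is weakly
increasing, the coefficient of `∏ x_{w j}` in `Q B` is the number of `π ∈ B` that are increasing on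
each fibre of `w` (`Q_content`). A rotation of `π ∈ A` with its largest value at position `p` has
this property exactly when `p` is the last position of its fibre and `π` is increasing on the fibres
of the word left after deleting the letter `w p` and rotating (`increasingOnFibers_rotate_iff`). No
fibre wraps around in that word, so it becomes weakly increasing after relabelling its letters, and
by symmetry the number of these `π` is the coefficient of `∏ x_{w j} / x_{w p}` in `Q A`
(`Q_content_of_relabelling`). There is one such `p` for each distinct letter of `w`, so the sum over `p` is
the coefficient of `∏ x_{w j}` in `Q A * p_1`.
-/

open scoped Pointwise
noncomputable section

namespace HorizontalRotation

open Representation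

/-! ### The character of an induced representation -/

section Induction

variable {k : Type*} [Field k] {G H : Type*} [Group G] [Group H] [Fintype G] [Fintype H]

instance finite_monoidAlgebra : Module.Finite k (MonoidAlgebra k H) :=
  Module.Finite.of_basis (MonoidAlgebra.basis H k)

omit [Group H] in
theorem trace_mapDomainLinearMap [DecidableEq H] (f : H → H) :
    LinearMap.trace k (MonoidAlgebra k H) (MonoidAlgebra.mapDomainLinearMap k k f) =
      ∑ x, if f x = x then (1 : k) else 0 := by
  rw [LinearMap.trace_eq_matrix_trace k (MonoidAlgebra.basis H k), Matrix.trace]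
  refine Finset.sum_congr rfl fun x _ => ?_
  simp [LinearMap.toMatrix_apply, MonoidAlgebra.basis, Finsupp.single_apply]

/-- The trace of a linear map on a space of coinvariants is the trace on the representation of its
composition with the projection `|G|⁻¹ ∑ g`. -/
theorem trace_coinvariants {W : Type*} [AddCommGroup W] [Module k W] [FiniteDimensional k W]
    (σ : Representation k G W) (hG : (Fintype.card G : k) ≠ 0) (f : IntertwiningMap σ σ) :
    LinearMap.trace k _ (Coinvariants.map σ σ f) =
      (Fintype.card G : k)⁻¹ * ∑ g, LinearMap.trace k W (f.toLinearMap ∘ₗ σ g) := by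
  let P : W →ₗ[k] W := (Fintype.card G : k)⁻¹ • ∑ g, σ g
  have hP : ∀ g, P ∘ₗ σ g = P := by
    intro g
    ext w
    simp only [P, LinearMap.comp_apply, LinearMap.smul_apply, LinearMap.sum_apply]
    congr 1
    rw [← Equiv.sum_comp (Equiv.mulRight g) (fun x => σ x w)]
    simp
  -- Averaging descends to a section `s` of the quotient map, and `s ∘ mk` is the projection `P`.
  let s := Coinvariants.lift σ P hP
  have hs : Coinvariants.mk σ ∘ₗ s = LinearMap.id := by
    apply Coinvariants.hom_ext
    ext w
    simp [s, P, hG, Coinvariants.mk_self_apply, ← Nat.cast_smul_eq_nsmul k, smul_smul]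
  calc LinearMap.trace k _ (Coinvariants.map σ σ f)
      = LinearMap.trace k _ (Coinvariants.mk σ ∘ₗ (f.toLinearMap ∘ₗ s)) := by
        rw [← LinearMap.comp_assoc, ← show _ = Coinvariants.mk σ ∘ₗ f.toLinearMap from
          Coinvariants.map_comp_mk f, LinearMap.comp_assoc, hs, LinearMap.comp_id]
    _ = LinearMap.trace k _ ((f.toLinearMap ∘ₗ s) ∘ₗ Coinvariants.mk σ) :=
        LinearMap.trace_comp_comm' _ _
    _ = LinearMap.trace k _ (f.toLinearMap ∘ₗ P) := by
        rw [LinearMap.comp_assoc, Coinvariants.lift_comp_mk]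
    _ = _ := by
        have hsum : f.toLinearMap ∘ₗ ∑ g, σ g = ∑ g, f.toLinearMap ∘ₗ σ g := by
          ext w
          simp
        rw [LinearMap.comp_smul, hsum, map_smul, map_sum, smul_eq_mul]

variable {V : Type*} [AddCommGroup V] [Module k V] [FiniteDimensional k V]

/-- The Frobenius formula for the character of an induced representation. -/
theorem character_ind [DecidableEq H] (φ : G →* H) (ρ : Representation k G V)
    (hG : (Fintype.card G : k) ≠ 0) (h : H) :
    (ind φ ρ).character h =
      (Fintype.card G : k)⁻¹ * ∑ g, ∑ x : H, if φ g * x * h⁻¹ = x then ρ.character g else 0 := by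
  rw [character]
  erw [trace_coinvariants _ hG]
  congr 1
  refine Finset.sum_congr rfl fun g _ => ?_
  have : ((MonoidAlgebra.mapDomainLinearMap k k fun x : H => x * h⁻¹).rTensor V) ∘ₗ
      (tprod ((leftRegular k H).comp φ) ρ) g = TensorProduct.map
        (MonoidAlgebra.mapDomainLinearMap k k fun x : H => φ g * x * h⁻¹) (ρ g) := by
    ext
    simp
  erw [this]
  rw [LinearMap.trace_tensorProduct', trace_mapDomainLinearMap, Finset.sum_mul]
  refine Finset.sum_congr rfl fun x _ => ?_
  split_ifs <;> simp [character]

/-- Averaging a class function against an induced character is averaging its restriction against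
the original character (Frobenius reciprocity for class functions with values in a module). -/
theorem sum_character_ind_smul {M : Type*} [AddCommGroup M] [Module k M]
    (φ : G →* H) (ρ : Representation k G V)
    (hG : (Fintype.card G : k) ≠ 0) (hH : (Fintype.card H : k) ≠ 0)
    (F : H → M) (hF : ∀ x h, F (x⁻¹ * h * x) = F h) :
    (Fintype.card H : k)⁻¹ • ∑ h, (ind φ ρ).character h • F h =
      (Fintype.card G : k)⁻¹ • ∑ g, ρ.character g • F (φ g) := by
  classical
  have key : ∀ g : G, ∑ h : H, ∑ x : H,
      (if φ g * x * h⁻¹ = x then ρ.character g else 0) • F h =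
        (Fintype.card H : k) • ρ.character g • F (φ g) := by
    intro g
    rw [Finset.sum_comm]
    have : ∀ x : H, ∑ h : H, (if φ g * x * h⁻¹ = x then ρ.character g else 0) • F h =
        ρ.character g • F (φ g) := by
      intro x
      rw [Finset.sum_eq_single (x⁻¹ * φ g * x)]
      · rw [hF, if_pos (by group)]
      · intro h _ hne
        rw [if_neg, zero_smul]
        intro e
        apply hne
        rw [mul_inv_eq_iff_eq_mul] at e
        rw [mul_assoc, e]
        group
      · simp
    rw [Finset.sum_congr rfl fun x _ => this x, Finset.sum_const, Finset.card_univ,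
      Nat.cast_smul_eq_nsmul k]
  simp only [character_ind φ ρ hG, mul_smul, ← Finset.smul_sum, Finset.sum_smul]
  rw [Finset.sum_comm]
  simp only [key, ← Finset.smul_sum]
  rw [smul_comm, inv_smul_smul₀ hH]

end Induction

/-! ### The Frobenius characteristic of an induced character -/

theorem powerSumPerm_conj {n : ℕ} (x π : Equiv.Perm (Fin n)) :
    powerSumPerm (x⁻¹ * π * x) = powerSumPerm π := by
  have : (x⁻¹ * π * x).cycleType = π.cycleType := by
    simpa using Equiv.Perm.cycleType_conj (σ := π) (τ := x⁻¹)
  simp only [powerSumPerm, Equiv.Perm.parts_partition, ← Equiv.Perm.sum_cycleType, this]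

theorem embed_castSucc {n : ℕ} (π : Equiv.Perm (Fin n)) (j : Fin n) :
    embed n π j.castSucc = (π j).castSucc :=
  Equiv.Perm.viaEmbedding_apply π Fin.castSuccEmb j

theorem embed_last {n : ℕ} (π : Equiv.Perm (Fin n)) : embed n π (Fin.last n) = Fin.last n :=
  Equiv.Perm.viaEmbedding_apply_of_notMem π Fin.castSuccEmb _ (by
    rintro ⟨j, hj⟩
    exact (Fin.castSucc_lt_last j).ne hj)

/-- `embed` adds one fixed point, hence one part equal to `1` to the cycle type. -/
theorem powerSumPerm_embed {n : ℕ} (π : Equiv.Perm (Fin n)) :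
    powerSumPerm (embed n π) = powerSumPerm π * powerSum 1 := by
  classical
  have h1 : (embed n π).cycleType = π.cycleType := by
    rw [embed, Equiv.Perm.viaEmbeddingHom_apply, Equiv.Perm.viaEmbedding]
    exact @Equiv.Perm.cycleType_extendDomain _ _ _ _ _ _ _ (fun a => Classical.propDecidable _) _ π
  have h2 : π.support.card ≤ n := by simpa using π.support.card_le_univ
  simp only [powerSumPerm, Equiv.Perm.parts_partition, ← Equiv.Perm.sum_cycleType, h1,
    Fintype.card_fin]
  rw [Equiv.Perm.sum_cycleType, Nat.succ_sub h2]
  simp [Multiset.replicate_succ, mul_comm]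

theorem ch_ind (n : ℕ) {V : Type*} [AddCommGroup V] [Module ℂ V] [FiniteDimensional ℂ V]
    (ρ : Representation ℂ (Equiv.Perm (Fin n)) V) :
    ch (ind (embed n) ρ).character = ch ρ.character * powerSum 1 := by
  have h := sum_character_ind_smul (embed n) ρ
    (by simp [Fintype.card_perm, Nat.factorial_ne_zero])
    (by simp [Fintype.card_perm, Nat.factorial_ne_zero]) powerSumPerm
    (fun x π => powerSumPerm_conj x π)
  simp only [Fintype.card_perm, Fintype.card_fin] at h
  rw [ch, h, ch, smul_mul_assoc, Finset.sum_mul]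
  simp only [powerSumPerm_embed, smul_mul_assoc]

/-! ### Symmetry of the Frobenius characteristic -/

open MvPowerSeries in
theorem rename_powerSum (τ : Equiv.Perm ℕ) (k : ℕ) : rename τ (powerSum k) = powerSum k := by
  ext m
  obtain ⟨m, rfl⟩ : ∃ m', m'.embDomain τ.toEmbedding = m :=
    ⟨m.embDomain τ.symm.toEmbedding, by ext i; simp [Finsupp.embDomain_eq_mapDomain,
      ← Finsupp.mapDomain_comp]⟩
  refine (coeff_embDomain_rename τ.toEmbedding (powerSum k) m).trans ?_
  change (Nat.card {i : ℕ // Finsupp.single i k = m} : ℂ) =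
    (Nat.card {i : ℕ // Finsupp.single i k = m.embDomain τ.toEmbedding} : ℂ)
  congr 1
  refine Nat.card_congr (τ.subtypeEquiv fun i => ?_)
  rw [← (Finsupp.embDomain_injective τ.toEmbedding).eq_iff, Finsupp.embDomain_single]
  rfl

open MvPowerSeries in
theorem rename_ch (τ : Equiv.Perm ℕ) {n : ℕ} (χ : Equiv.Perm (Fin n) → ℂ) :
    rename τ (ch χ) = ch χ := by
  have h : ∀ π : Equiv.Perm (Fin n), rename τ (powerSumPerm π) = powerSumPerm π := by
    intro π
    rw [powerSumPerm, map_multiset_prod, Multiset.map_map]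
    simp only [Function.comp_def, rename_powerSum]
  simp only [ch, map_smul, map_sum, h]

theorem ch_mapDomain (τ : Equiv.Perm ℕ) {n : ℕ} (χ : Equiv.Perm (Fin n) → ℂ) (m : ℕ →₀ ℕ) :
    ch χ (m.mapDomain τ) = ch χ m := by
  have h := MvPowerSeries.coeff_embDomain_rename τ.toEmbedding (ch χ) m
  rw [Finsupp.embDomain_eq_mapDomain] at h
  erw [rename_ch] at h
  exact h

/-! ### Coefficients of `Q B` as numbers of permutations -/

/-- The exponent of the monomial `∏ j, x_{w j}` of a word `w`. -/
def content {n : ℕ} (w : Fin n → ℕ) : ℕ →₀ ℕ := ∑ j, Finsupp.single (w j) 1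

/-- The restriction of `π` to each fibre of the word `w` is increasing. -/
def IncreasingOnFibers {n : ℕ} (w : Fin n → ℕ) (π : Equiv.Perm (Fin n)) : Prop :=
  ∀ i j, i < j → w i = w j → π i < π j

theorem content_comp_perm {n : ℕ} (w : Fin n → ℕ) (e : Equiv.Perm (Fin n)) :
    content (w ∘ e) = content w :=
  Equiv.sum_comp e fun j => Finsupp.single (w j) 1

theorem exists_monotone_content_eq {n : ℕ} (w : Fin n → ℕ) :
    ∃ v : Fin n → ℕ, Monotone v ∧ content v = content w :=
  ⟨_, Tuple.monotone_sort w, content_comp_perm w _⟩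

theorem mapDomain_content {n : ℕ} (τ : ℕ → ℕ) (w : Fin n → ℕ) :
    (content w).mapDomain τ = content (τ ∘ w) := by
  simp [content, Finsupp.mapDomain_finsetSum, Finsupp.mapDomain_single]

/-- A weakly increasing word is determined by its content, being a sorted list. -/
theorem eq_of_content_eq {n : ℕ} {v w : Fin n → ℕ} (hv : Monotone v) (hw : Monotone w)
    (h : content v = content w) : v = w := by
  have key : ∀ u : Fin n → ℕ, content u = Multiset.toFinsupp (List.ofFn u : Multiset ℕ) := by
    intro u
    ext i
    rw [Multiset.toFinsupp_apply, ← Fin.univ_val_map, Multiset.count_map]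
    simp [content, Finsupp.finsetSum_apply, Finsupp.single_apply, eq_comm, Finset.card_def]
  rw [key, key, EmbeddingLike.apply_eq_iff_eq, Multiset.coe_eq_coe] at h
  exact List.ofFn_injective (h.eq_of_sortedLE hv.sortedLE_ofFn hw.sortedLE_ofFn)

/-- For a weakly increasing word, strictness at the descents of `π` is the same as `π` being
increasing on the maximal constant blocks. -/
theorem increasingOnFibers_iff {n : ℕ} {w : Fin n → ℕ} (hw : Monotone w)
    (π : Equiv.Perm (Fin n)) :
    IncreasingOnFibers w π ↔ ∀ d ∈ descentSet π, ∀ j k : Fin n,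
      (j : ℕ) + 1 = d → (k : ℕ) = d → w j < w k := by
  constructor
  · rintro h d ⟨j, k, hj, hk, hd⟩ j' k' hj' hk'
    obtain rfl : j = j' := Fin.ext (by omega)
    obtain rfl : k = k' := Fin.ext (by omega)
    have hjk : j < k := Fin.lt_def.2 (by omega)
    exact (hw hjk.le).lt_of_ne fun e => (h j k hjk e).not_gt hd
  · intro h i j
    obtain ⟨j, hj⟩ := j
    induction j with
    | zero => exact fun hij => absurd hij (by simp [Fin.lt_def])
    | succ j ih =>
      intro hij hwij
      have hij' : (i : ℕ) < j + 1 := hij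
      let k : Fin n := ⟨j, by omega⟩
      have hik : i ≤ k := Fin.le_def.2 (by simp only [k]; omega)
      have hkj : k ≤ ⟨j + 1, hj⟩ := Fin.le_def.2 (by simp [k])
      have hwk : w i = w k := le_antisymm (hw hik) (hwij ▸ hw hkj)
      have hstep : π k < π ⟨j + 1, hj⟩ := by
        by_contra hlt
        have hne : π ⟨j + 1, hj⟩ ≠ π k := fun e => by
          have := π.injective e
          simp [k, Fin.ext_iff] at this
        have := h (j + 1) ⟨k, ⟨j + 1, hj⟩, rfl, rfl, lt_of_le_of_ne (not_lt.1 hlt) hne⟩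
          k ⟨j + 1, hj⟩ rfl rfl
        omega
      rcases hik.eq_or_lt with heq | hlt
      · rwa [heq]
      · exact (ih _ hlt hwk).trans hstep

open Classical in
theorem fundamental_content {n : ℕ} {w : Fin n → ℕ} (hw : Monotone w)
    (π : Equiv.Perm (Fin n)) :
    fundamental n (descentSet π) (content w) = if IncreasingOnFibers w π then 1 else 0 := by
  rw [fundamental]
  split_ifs with h
  · rw [increasingOnFibers_iff hw] at h
    rw [Nat.cast_eq_one, Nat.card_eq_one_iff_unique]
    exact ⟨⟨fun a b => Subtype.ext
      (eq_of_content_eq a.2.1 b.2.1 (a.2.2.2.trans b.2.2.2.symm))⟩, ⟨⟨w, hw, h, rfl⟩⟩⟩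
  · rw [Nat.cast_eq_zero, Nat.card_eq_zero]
    refine Or.inl ⟨fun a => h ?_⟩
    rw [increasingOnFibers_iff hw, ← eq_of_content_eq a.2.1 hw a.2.2.2]
    exact a.2.2.1

theorem Q_apply {n : ℕ} (B : Set (Equiv.Perm (Fin n))) (m : ℕ →₀ ℕ) :
    Q B m = ∑ π ∈ B.toFinite.toFinset, fundamental n (descentSet π) m := by
  rw [Q, finsum_mem_eq_finite_toFinset_sum _ B.toFinite]
  exact map_sum (MvPowerSeries.coeff m) _ _

theorem Q_content {n : ℕ} (B : Set (Equiv.Perm (Fin n))) {w : Fin n → ℕ} (hw : Monotone w) :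
    Q B (content w) = (Nat.card {π // π ∈ B ∧ IncreasingOnFibers w π} : ℂ) := by
  classical
  rw [Q_apply]
  simp only [fundamental_content hw]
  rw [Finset.sum_boole, Nat.card_eq_fintype_card, Fintype.card_subtype]
  congr 2
  ext π
  simp

theorem exists_content_eq_of_Q_ne_zero {n : ℕ} {B : Set (Equiv.Perm (Fin n))} {m : ℕ →₀ ℕ}
    (h : Q B m ≠ 0) : ∃ w : Fin n → ℕ, Monotone w ∧ content w = m := by
  rw [Q_apply] at h
  obtain ⟨π, -, hπ⟩ := Finset.exists_ne_zero_of_sum_ne_zero h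
  rw [fundamental, Nat.cast_ne_zero, Nat.card_ne_zero] at hπ
  obtain ⟨⟨w, hw, -, hm⟩⟩ := hπ.1
  exact ⟨w, hw, hm⟩

/-- If `Q B` is symmetric, then its coefficients count permutations increasing on the fibres of a
word, even when the word is weakly increasing only after a relabelling `τ` of its letters. -/
theorem Q_content_of_relabelling {n : ℕ} {B : Set (Equiv.Perm (Fin n))}
    (hB : ∀ (τ : Equiv.Perm ℕ) (m : ℕ →₀ ℕ), Q B (m.mapDomain τ) = Q B m)
    {w : Fin n → ℕ} (τ : Equiv.Perm ℕ) (hw : Monotone (τ ∘ w)) :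
    Q B (content w) = (Nat.card {π // π ∈ B ∧ IncreasingOnFibers w π} : ℂ) := by
  rw [← hB τ, mapDomain_content, Q_content B hw]
  simp only [IncreasingOnFibers, Function.comp_apply, τ.injective.eq_iff]

/-! ### Horizontal rotations -/

/-- The rotation of `π` in which the largest value `n` stands at position `p`. -/
def rotate {n : ℕ} (p : Fin (n + 1)) (π : Equiv.Perm (Fin n)) : Equiv.Perm (Fin (n + 1)) :=
  embed n π * (Equiv.addRight (1 + p))⁻¹

/-- The word obtained from `w` by removing the letter at position `p` and cyclically rotating so
that the letter after it comes first. -/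
def cutAt {n : ℕ} (w : Fin (n + 1) → ℕ) (p : Fin (n + 1)) (j : Fin n) : ℕ :=
  w (j.castSucc + (1 + p))

theorem last_add_one_add {n : ℕ} (p : Fin (n + 1)) : Fin.last n + (1 + p) = p := by
  rw [← add_assoc, Fin.last_add_one, zero_add]

theorem rotate_castSucc {n : ℕ} (p : Fin (n + 1)) (π : Equiv.Perm (Fin n)) (j : Fin n) :
    rotate p π (j.castSucc + (1 + p)) = (π j).castSucc :=
  (congrArg (embed n π) ((Equiv.addRight (1 + p)).symm_apply_apply _)).trans
    (embed_castSucc π j)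

theorem rotate_self {n : ℕ} (p : Fin (n + 1)) (π : Equiv.Perm (Fin n)) :
    rotate p π p = Fin.last n := by
  have : rotate p π (Fin.last n + (1 + p)) = Fin.last n :=
    (congrArg (embed n π) ((Equiv.addRight (1 + p)).symm_apply_apply _)).trans
      (embed_last π)
  rwa [last_add_one_add] at this

theorem rotate_injective {n : ℕ} :
    Function.Injective fun a : Fin (n + 1) × Equiv.Perm (Fin n) => rotate a.1 a.2 := by
  rintro ⟨p, π⟩ ⟨q, σ⟩ h
  simp only at h
  obtain rfl : p = q := by
    apply (rotate p π).injective
    rw [rotate_self, h, rotate_self]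
  refine Prod.ext rfl (Equiv.ext fun j => Fin.castSucc_injective n ?_)
  rw [← rotate_castSucc p, h, rotate_castSucc]

theorem mem_rotations_iff {n : ℕ} {A : Set (Equiv.Perm (Fin n))}
    {σ : Equiv.Perm (Fin (n + 1))} :
    σ ∈ rotations A ↔ ∃ p, ∃ π ∈ A, rotate p π = σ := by
  have hc : finRotate (n + 1) = Equiv.addRight 1 := by
    ext x
    simp
  have hpow : ∀ k : ℕ, Equiv.addRight (1 : Fin (n + 1)) ^ k = Equiv.addRight (k • 1) := by
    intro k
    induction k with
    | zero => ext x; simp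
    | succ k ih => ext x; simp [pow_succ', ih, succ_nsmul, add_assoc]
  have hmem : ∀ a : Fin (n + 1), Equiv.addRight a ∈ Subgroup.zpowers (Equiv.addRight 1) := by
    intro a
    induction a using Fin.induction with
    | zero =>
      convert one_mem (Subgroup.zpowers (Equiv.addRight (1 : Fin (n + 1))))
      ext x
      simp
    | succ i ih =>
      convert mul_mem (Subgroup.mem_zpowers (Equiv.addRight (1 : Fin (n + 1)))) ih
      ext x
      simp [← Fin.coeSucc_eq_succ, add_assoc]
  rw [rotations, hc, Set.mem_mul]
  constructor
  · rintro ⟨_, ⟨π, hπ, rfl⟩, y, hy, rfl⟩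
    obtain ⟨k, rfl⟩ := mem_powers_iff_mem_zpowers.2 hy
    refine ⟨-(k • 1) - 1, π, hπ, ?_⟩
    simp only [rotate, hpow]
    congr 1
    rw [inv_eq_iff_eq_inv]
    ext x
    simp [Equiv.Perm.inv_def]
  · rintro ⟨p, π, hπ, rfl⟩
    exact ⟨_, ⟨π, hπ, rfl⟩, _, inv_mem (hmem _), rfl⟩

theorem exists_castSucc_add_eq {n : ℕ} {p x : Fin (n + 1)} (h : x ≠ p) :
    ∃ j : Fin n, j.castSucc + (1 + p) = x := by
  refine ⟨(x - (1 + p)).castPred fun e => h ?_, by simp⟩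
  rw [sub_eq_iff_eq_add] at e
  rw [e, last_add_one_add]

/-- Removing position `p` cyclically: positions of `cutAt w p` before the wrap come from positions
of `w` after `p`, those from the wrap on come from positions before `p`. -/
theorem val_castSucc_add {n : ℕ} (p : Fin (n + 1)) (j : Fin n) :
    ((j.castSucc + (1 + p) : Fin (n + 1)) : ℕ) =
      if (j : ℕ) + p < n then (j : ℕ) + 1 + p else (j : ℕ) + p - n := by
  have hj := j.2
  have hp := p.2
  have : j.castSucc + (1 + p) = j.succ + p := by rw [← add_assoc, Fin.coeSucc_eq_succ]
  rw [this, Fin.val_add_eq_ite, Fin.val_succ]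
  split_ifs <;> omega

/-- The largest value must stand at the end of a constant block of `w`. -/
theorem lt_of_increasingOnFibers_rotate {n : ℕ} {w : Fin (n + 1) → ℕ} (hw : Monotone w)
    {p : Fin (n + 1)} {π : Equiv.Perm (Fin n)} (h : IncreasingOnFibers w (rotate p π))
    {q : Fin (n + 1)} (hq : p < q) : w p < w q := by
  refine (hw hq.le).lt_of_ne fun e => ?_
  have := h p q hq e
  rw [rotate_self] at this
  exact this.not_ge (Fin.le_last _)

/-- Since the fibre of `w` ending at `p` lies entirely at positions `≤ p`, no fibre of `cutAt w p`
meets both sides of the wrap, so two positions in one fibre keep their order. -/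
theorem increasingOnFibers_rotate_iff {n : ℕ} {w : Fin (n + 1) → ℕ} (hw : Monotone w)
    {p : Fin (n + 1)} (hp : ∀ q, p < q → w p < w q) (π : Equiv.Perm (Fin n)) :
    IncreasingOnFibers w (rotate p π) ↔ IncreasingOnFibers (cutAt w p) π := by
  constructor
  · intro h i j hij hwij
    have hij' : (i : ℕ) < j := hij
    rw [← Fin.castSucc_lt_castSucc_iff, ← rotate_castSucc p, ← rotate_castSucc p]
    refine h _ _ ?_ hwij
    rw [cutAt, cutAt] at hwij
    have hi := val_castSucc_add p i
    have hj := val_castSucc_add p j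
    generalize i.castSucc + (1 + p) = x at *
    generalize j.castSucc + (1 + p) = y at *
    by_contra hxy
    have hxy' : (y : ℕ) ≤ x := not_lt.1 hxy
    -- The letter at `p` would separate the two equal letters.
    have hyp : y ≤ p := Fin.le_def.2 (by split_ifs at hi hj <;> omega)
    have hpx : p < x := Fin.lt_def.2 (by split_ifs at hi hj <;> omega)
    have := hw hyp
    have := hp x hpx
    omega
  · intro h x y hxy hwxy
    have hxp : x ≠ p := by
      rintro rfl
      exact (hp y hxy).ne hwxy
    obtain ⟨i, rfl⟩ := exists_castSucc_add_eq hxp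
    by_cases hyp : y = p
    · rw [hyp, rotate_self, rotate_castSucc]
      exact Fin.castSucc_lt_last _
    obtain ⟨j, rfl⟩ := exists_castSucc_add_eq hyp
    rw [rotate_castSucc, rotate_castSucc, Fin.castSucc_lt_castSucc_iff]
    refine h i j ?_ hwxy
    have hi := val_castSucc_add p i
    have hj := val_castSucc_add p j
    generalize i.castSucc + (1 + p) = x at *
    generalize j.castSucc + (1 + p) = y at *
    by_contra hij
    have hij' : (j : ℕ) ≤ i := not_lt.1 hij
    have hxy' : (x : ℕ) < y := hxy
    have hjn := j.2
    -- Again `p` would lie strictly between the two equal letters, whose order the wrap reversed.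
    have hxp' : x ≤ p := Fin.le_def.2 (by split_ifs at hi hj <;> omega)
    have hpy : p < y := Fin.lt_def.2 (by split_ifs at hi hj <;> omega)
    have := hw hxp'
    have := hp y hpy
    omega

theorem content_cutAt_add {n : ℕ} (w : Fin (n + 1) → ℕ) (p : Fin (n + 1)) :
    content (cutAt w p) + Finsupp.single (w p) 1 = content w := by
  rw [← content_comp_perm w (Equiv.addRight (1 + p)), content, content, Fin.sum_univ_castSucc]
  simp [cutAt, last_add_one_add]

/-- The permutation of `ℕ` that moves the interval `(a, M]` in front of `[0, a]`. -/
def swapIntervals (a M : ℕ) (h : a ≤ M) : Equiv.Perm ℕ where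
  toFun v := if v ≤ a then v + (M - a) else if v ≤ M then v - a - 1 else v
  invFun u := if u < M - a then u + a + 1 else if u ≤ M then u - (M - a) else u
  left_inv v := by simp only; split_ifs <;> omega
  right_inv u := by simp only; split_ifs <;> omega

/-- The letters of `cutAt w p` exceeding `w p` all come before the letters `≤ w p`, so moving them
below makes the word weakly increasing. -/
theorem exists_monotone_comp_cutAt {n : ℕ} {w : Fin (n + 1) → ℕ} (hw : Monotone w)
    {p : Fin (n + 1)} (hp : ∀ q, p < q → w p < w q) :
    ∃ τ : Equiv.Perm ℕ, Monotone (τ ∘ cutAt w p) := by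
  refine ⟨swapIntervals (w p) (w (Fin.last n)) (hw (Fin.le_last p)), fun i j hij => ?_⟩
  have hij' : (i : ℕ) ≤ j := hij
  simp only [Function.comp_apply, cutAt]
  have hi := val_castSucc_add p i
  have hj := val_castSucc_add p j
  generalize i.castSucc + (1 + p) = x at *
  generalize j.castSucc + (1 + p) = y at *
  have hjn := j.2
  have hwx := hw (Fin.le_last x)
  have hwy := hw (Fin.le_last y)
  have hwp := hw (Fin.le_last p)
  have hgt : ∀ z : Fin (n + 1), w z ≤ w p ↔ z ≤ p := fun z =>
    ⟨fun h => not_lt.1 fun hlt => (hp z hlt).not_ge h, fun h => hw h⟩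
  simp only [swapIntervals, Equiv.coe_fn_mk, hgt, if_pos hwx, if_pos hwy, Fin.le_def]
  have hx := hgt x
  have hy := hgt y
  rw [Fin.le_def] at hx hy
  have hmono : (x : ℕ) ≤ y → w x ≤ w y := fun h => hw h
  split_ifs at hi hj ⊢ <;> omega

/-- The coefficient of `Q (rotations A)`, split according to the position of the largest value. -/
theorem card_rotations {n : ℕ} (A : Set (Equiv.Perm (Fin n))) {w : Fin (n + 1) → ℕ}
    (hw : Monotone w) :
    Nat.card {σ // σ ∈ rotations A ∧ IncreasingOnFibers w σ} =
      ∑ p with ∀ q, p < q → w p < w q,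
        Nat.card {π // π ∈ A ∧ IncreasingOnFibers (cutAt w p) π} := by
  classical
  let S := Finset.univ.filter fun p : Fin (n + 1) => ∀ q, p < q → w p < w q
  let T := fun p => Finset.univ.filter fun π : Equiv.Perm (Fin n) =>
    π ∈ A ∧ IncreasingOnFibers (cutAt w p) π
  simp only [Nat.card_eq_fintype_card, Fintype.card_subtype]
  change _ = ∑ p ∈ S, (T p).card
  rw [← Finset.card_sigma, eq_comm]
  refine Finset.card_bij (fun a _ => rotate a.1 a.2) ?_ ?_ ?_
  · rintro ⟨p, π⟩ h
    simp only [S, T, Finset.mem_sigma, Finset.mem_filter, Finset.mem_univ, true_and] at h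
    rw [Finset.mem_filter]
    exact ⟨Finset.mem_univ _, mem_rotations_iff.2 ⟨p, π, h.2.1, rfl⟩,
      (increasingOnFibers_rotate_iff hw h.1 π).2 h.2.2⟩
  · rintro ⟨p, π⟩ - ⟨q, σ⟩ - h
    have := @rotate_injective n (p, π) (q, σ) h
    rw [Prod.mk.injEq] at this
    rw [this.1, this.2]
  · intro σ hσ
    obtain ⟨-, hσA, hσ⟩ := Finset.mem_filter.1 hσ
    obtain ⟨p, π, hπ, rfl⟩ := mem_rotations_iff.1 hσA
    have hp : ∀ q, p < q → w p < w q := fun q hq => lt_of_increasingOnFibers_rotate hw hσ hq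
    refine ⟨⟨p, π⟩, ?_, rfl⟩
    simp only [S, T, Finset.mem_sigma, Finset.mem_filter, Finset.mem_univ, true_and]
    exact ⟨hp, hπ, (increasingOnFibers_rotate_iff hw hp π).1 hσ⟩

/-! ### Multiplication by `p_1` -/

theorem powerSum_one_single (i : ℕ) : powerSum 1 (Finsupp.single i 1) = 1 := by
  rw [powerSum, Nat.cast_eq_one, Nat.card_eq_one_iff_unique]
  refine ⟨⟨fun a b => Subtype.ext ?_⟩, ⟨⟨i, rfl⟩⟩⟩
  exact Finsupp.single_left_injective one_ne_zero (a.2.trans b.2.symm)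

theorem exists_eq_single_of_powerSum_one_ne_zero {m : ℕ →₀ ℕ} (h : powerSum 1 m ≠ 0) :
    ∃ i, Finsupp.single i 1 = m := by
  rw [powerSum, Nat.cast_ne_zero, Nat.card_ne_zero] at h
  obtain ⟨⟨i, hi⟩⟩ := h.1
  exact ⟨i, hi⟩

theorem exists_last_eq_of_mem_support_content {n : ℕ} {w : Fin (n + 1) → ℕ} (hw : Monotone w)
    {i : ℕ} (hi : content w i ≠ 0) : ∃ p, w p = i ∧ ∀ q, p < q → w p < w q := by
  classical
  have hne : (Finset.univ.filter fun q => w q = i).Nonempty := by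
    rw [content, Finsupp.finsetSum_apply] at hi
    obtain ⟨q, -, hq⟩ := Finset.exists_ne_zero_of_sum_ne_zero hi
    refine ⟨q, Finset.mem_filter.2 ⟨Finset.mem_univ _, ?_⟩⟩
    by_contra hne
    exact hq (Finsupp.single_eq_of_ne' hne)
  have hmem := (Finset.mem_filter.1 (Finset.max'_mem _ hne)).2
  refine ⟨_, hmem, fun q hq => (hw hq.le).lt_of_ne fun e => ?_⟩
  exact hq.not_ge (Finset.le_max' _ q (Finset.mem_filter.2 ⟨Finset.mem_univ _, e.symm.trans hmem⟩))

/-- Each letter of `w` is represented by the last position `p` at which it occurs. -/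
theorem mul_powerSum_one_content (f : MvPowerSeries ℕ ℂ) {n : ℕ} {w : Fin (n + 1) → ℕ}
    (hw : Monotone w) :
    (f * powerSum 1) (content w) = ∑ p with ∀ q, p < q → w p < w q, f (content (cutAt w p)) := by
  classical
  refine (MvPowerSeries.coeff_mul (content w) f (powerSum 1)).trans ?_
  symm
  refine Finset.sum_of_injOn (fun p => (content (cutAt w p), Finsupp.single (w p) 1)) ?_ ?_ ?_ ?_
  · intro p hp q hq h
    have e : w p = w q := Finsupp.single_left_injective one_ne_zero (Prod.ext_iff.1 h).2
    rcases lt_trichotomy p q with hlt | heq | hlt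
    · exact absurd e ((Finset.mem_filter.1 hp).2 q hlt).ne
    · exact heq
    · exact absurd e.symm ((Finset.mem_filter.1 hq).2 p hlt).ne
  · intro p _
    simp [content_cutAt_add]
  · rintro ⟨a, b⟩ hab hni
    replace hab := Finset.HasAntidiagonal.mem_antidiagonal.1 hab
    by_contra hne
    obtain ⟨i, rfl⟩ := exists_eq_single_of_powerSum_one_ne_zero (right_ne_zero_of_mul hne)
    obtain ⟨p, rfl, hp⟩ := exists_last_eq_of_mem_support_content (i := i) hw (by simp [← hab])
    refine hni ⟨p, by simpa using hp, Prod.ext ?_ rfl⟩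
    exact add_right_cancel ((content_cutAt_add w p).trans hab.symm)
  · intro p _
    change _ = f _ * powerSum 1 _
    rw [powerSum_one_single, mul_one]

/-- If `Q A` is a symmetric power series, then rotating `A` multiplies `Q A` by `p_1`. -/
theorem Q_rotations {n : ℕ} {A : Set (Equiv.Perm (Fin n))}
    (hA : ∀ (τ : Equiv.Perm ℕ) (m : ℕ →₀ ℕ), Q A (m.mapDomain τ) = Q A m) :
    Q (rotations A) = Q A * powerSum 1 := by
  classical
  have hword : ∀ w : Fin (n + 1) → ℕ, Monotone w →
      Q (rotations A) (content w) = (Q A * powerSum 1) (content w) := by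
    intro w hw
    rw [Q_content _ hw, card_rotations A hw, mul_powerSum_one_content _ hw, Nat.cast_sum]
    refine Finset.sum_congr rfl fun p hp => ?_
    obtain ⟨τ, hτ⟩ := exists_monotone_comp_cutAt hw (Finset.mem_filter.1 hp).2
    exact (Q_content_of_relabelling hA τ hτ).symm
  funext m
  by_cases hm : ∃ w : Fin (n + 1) → ℕ, Monotone w ∧ content w = m
  · obtain ⟨w, hw, rfl⟩ := hm
    exact hword w hw
  · -- Both series are homogeneous of degree `n + 1`.
    have h1 : Q (rotations A) m = 0 := by
      by_contra hne
      exact hm (exists_content_eq_of_Q_ne_zero hne)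
    rw [h1]
    refine ((MvPowerSeries.coeff_mul m (Q A) (powerSum 1)).trans
      (Finset.sum_eq_zero fun ab hab => ?_)).symm
    by_contra hne
    replace hab := Finset.HasAntidiagonal.mem_antidiagonal.1 hab
    obtain ⟨i, hi⟩ := exists_eq_single_of_powerSum_one_ne_zero (right_ne_zero_of_mul hne)
    obtain ⟨v, -, hv⟩ := exists_content_eq_of_Q_ne_zero (left_ne_zero_of_mul hne)
    obtain ⟨w, hw, hwm⟩ := exists_monotone_content_eq (Fin.cons i v : Fin (n + 1) → ℕ)
    refine hm ⟨w, hw, hwm.trans ?_⟩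
    rw [← hab, ← hi, ← hv, content, Fin.sum_univ_succ, add_comm]
    simp [content]

end HorizontalRotation

end

theorem theorem2p2 (n : ℕ) {V : Type*} [AddCommGroup V] [Module ℂ V] [FiniteDimensional ℂ V]
    (ρ : Representation ℂ (Equiv.Perm (Fin n)) V) (A : Set (Equiv.Perm (Fin n)))
    (h : HorizontalRotation.Q A = HorizontalRotation.ch ρ.character) :
    HorizontalRotation.Q (HorizontalRotation.rotations A) =
      HorizontalRotation.ch (Representation.ind (HorizontalRotation.embed n) ρ).character := by
  rw [HorizontalRotation.ch_ind, ← h]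
  refine HorizontalRotation.Q_rotations fun τ m => ?_
  rw [h, HorizontalRotation.ch_mapDomain]
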